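/- Let $D\subset\mathbb C^n$ be a domain (a nonempty connected open set), let $\{v_a\}_{a\in A}$ be a nonempty family of continuous real-valued functions on $D$ that is uniformly locally bounded, i.e. for every compact $K\subset D$ there is a constant $C_K$ with $|v_a|\le C_K$ on $K$ for all $a\in A$, and let $B\in\mathbb R$. For a locally integrable function $u$ on $D$, write $|\Delta u|\le B$ if the Laplacian of $u$ on $D\subset\mathbb R^{2n}$ in the sense of distributions is a function $g$ with $|g|\le B$ almost everywhere on $D$. Suppose that $|\Delta v_a|\le B$ for all $a\in A$, and that the pointwise infimum $v_{\min}=\inf_{a\in A}v_a$ is plurisubharmonic on $D$. Then $|\Delta v_{\min}|\le B$. -/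

import Mathlib

open MeasureTheory
open scoped ContDiff InnerProductSpace

/-- `g` is the Laplacian of `u` on `D` in the sense of distributions: both are locally integrable
on `D`, and `∫_D u Δφ = ∫_D g φ` for every smooth `φ` with compact support contained in `D`. -/
structure IsWeakLaplacianOn {E : Type*} [NormedAddCommGroup E] [InnerProductSpace ℝ E]
    [FiniteDimensional ℝ E] [MeasurableSpace E] [BorelSpace E]
    (D : Set E) (u g : E → ℝ) : Prop where
  locallyIntegrableOn : LocallyIntegrableOn u D volume
  locallyIntegrableOn_laplacian : LocallyIntegrableOn g D volume
  integral_eq : ∀ φ : E → ℝ, ContDiff ℝ ∞ φ → HasCompactSupport φ → tsupport φ ⊆ D →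
    ∫ x in D, u x * Laplacian.laplacian φ x = ∫ x in D, g x * φ x

/-- `|Δu| ≤ B` on `D`: the distributional Laplacian of `u` on `D` is (given by) a function which is
bounded by `B` almost everywhere on `D`. -/
def AbsLaplacianLEOn {E : Type*} [NormedAddCommGroup E] [InnerProductSpace ℝ E]
    [FiniteDimensional ℝ E] [MeasurableSpace E] [BorelSpace E]
    (D : Set E) (u : E → ℝ) (B : ℝ) : Prop :=
  ∃ g : E → ℝ, IsWeakLaplacianOn D u g ∧ ∀ᵐ x ∂(volume.restrict D), |g x| ≤ B

/-- A real-valued function `u` is plurisubharmonic on `D ⊆ ℂⁿ`: it is upper semicontinuous on `D`,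
and for every closed complex disc `{z + ζ w : |ζ| ≤ 1}` contained in `D` the value of `u` at the
centre is at most its mean over the boundary circle.
(For a real-valued upper semicontinuous function, the mean over the circle being `> -∞` is the same
as integrability over the circle, which is therefore part of the mean value inequality.) -/
structure IsPSHOn {n : ℕ} (D : Set (EuclideanSpace ℂ (Fin n))) (u : EuclideanSpace ℂ (Fin n) → ℝ) :
    Prop where
  upperSemicontinuousOn : UpperSemicontinuousOn u D
  le_circleAverage : ∀ z w : EuclideanSpace ℂ (Fin n),
    (∀ ζ : ℂ, ‖ζ‖ ≤ 1 → z + ζ • w ∈ D) →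
      CircleIntegrable (fun ζ : ℂ => u (z + ζ • w)) 0 1 ∧
        u z ≤ Real.circleAverage (fun ζ : ℂ => u (z + ζ • w)) 0 1

/-- The family `v` is uniformly locally bounded on `D`: on each compact subset of `D`, all members
of the family are bounded by one and the same constant. -/
def UniformlyLocallyBoundedOn {A X : Type*} [TopologicalSpace X] (D : Set X) (v : A → X → ℝ) :
    Prop :=
  ∀ K : Set X, K ⊆ D → IsCompact K → ∃ C : ℝ, ∀ a : A, ∀ x ∈ K, |v a x| ≤ C

/-!
Let `M u r x` be the mean of `u` over the ball of radius `r` about `x`, weighted by a fixed smooth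
radial kernel. The derivative of `M u r x` in `r` is the integral of `Δu` against a nonnegative
rescaled bump; so if `u` is continuous and `Δu ≤ B` weakly, then `M u r x ≤ u x + B κ r²` for a
dimensional constant `κ`. Unlike the differential inequality, this mean value inequality passes to
infima. Conversely, `M φ r = φ + κ r² Δφ + o(r²)` uniformly for test functions `φ`, and `M · r` is
symmetric, so the mean value inequality gives back `Δu ≤ B` weakly. In the same way a
plurisubharmonic function has nonnegative distributional Laplacian, since averaging its mean value
inequality on discs over all directions gives `u x ≤ M u r x`. Finally, a distribution lying between
`-B` and `B` is bounded by `B` in the `L¹` norm on test functions, and is therefore a function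
bounded by `B` because the dual of `L¹` is `L^∞`.
-/

open Filter Topology Metric Laplacian TopologicalSpace
open scoped Distributions

section Laplacian

variable {E F : Type*} [NormedAddCommGroup E] [InnerProductSpace ℝ E] [FiniteDimensional ℝ E]
  [NormedAddCommGroup F] [NormedSpace ℝ F]

lemma tsupport_laplacian_subset (f : E → F) : tsupport (Δ f) ⊆ tsupport f := by
  refine closure_minimal (fun x hx => ?_) (isClosed_tsupport f)
  by_contra hxf
  refine hx ?_
  have h : iteratedFDeriv ℝ 2 f x = 0 :=
    image_eq_zero_of_notMem_tsupport fun h => hxf (tsupport_iteratedFDeriv_subset 2 h)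
  simp [InnerProductSpace.laplacian_eq_iteratedFDeriv_stdOrthonormalBasis, h]

lemma contDiff_laplacian {n : ℕ∞} {f : E → F} (hf : ContDiff ℝ (n + 2) f) :
    ContDiff ℝ n (Δ f) := by
  rw [InnerProductSpace.laplacian_eq_iteratedFDeriv_stdOrthonormalBasis]
  have h : ContDiff ℝ n (iteratedFDeriv ℝ 2 f) := hf.iteratedFDeriv_right le_rfl
  exact ContDiff.sum fun i _ =>
    (ContinuousMultilinearMap.apply ℝ (fun _ : Fin 2 => E) F _).contDiff.comp h

lemma laplacian_comp_smul_sub {f : E → F} (hf : ContDiff ℝ 2 f) (c : ℝ) (a x : E) :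
    Δ (fun y => f (c • (y - a))) x = c ^ 2 • Δ f (c • (x - a)) := by
  have h : iteratedFDeriv ℝ 2 (fun y => f (c • (y - a))) x =
      c ^ 2 • iteratedFDeriv ℝ 2 f (c • (x - a)) := by
    rw [iteratedFDeriv_comp_sub 2 (f := fun y => f (c • y)) a x,
      iteratedFDeriv_comp_const_smul c hf]
  simp only [InnerProductSpace.laplacian_eq_iteratedFDeriv_stdOrthonormalBasis, h,
    Finset.smul_sum, smul_apply]

/-- The field `P' = -K ⟪·, z⟫` has divergence `-(d K + ⟪∇K, z⟫)`. -/
lemma laplacian_of_hasFDerivAt_neg_smul_innerSL {P K : E → ℝ}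
    (hP : ∀ z, HasFDerivAt P (-(K z) • innerSL ℝ z) z) {z : E} (hK : DifferentiableAt ℝ K z) :
    Δ P z = -(Module.finrank ℝ E * K z + fderiv ℝ K z z) := by
  have hP' : fderiv ℝ P = fun z => -(K z) • innerSL ℝ z := funext fun z => (hP z).fderiv
  have hP'' : HasFDerivAt (fun z => -(K z) • innerSL ℝ z) _ z :=
    hK.hasFDerivAt.neg.smul (innerSL ℝ : E →L[ℝ] E →L[ℝ] ℝ).hasFDerivAt
  set e := stdOrthonormalBasis ℝ E
  have hz : ∑ i, inner ℝ (e i) z * fderiv ℝ K z (e i) = fderiv ℝ K z z := by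
    simpa only [map_sum, map_smul, smul_eq_mul] using congrArg (fderiv ℝ K z) (e.sum_repr' z)
  have hi : ∀ i, iteratedFDeriv ℝ 2 P z ![e i, e i] =
      -(K z + inner ℝ (e i) z * fderiv ℝ K z (e i)) := by
    intro i
    have hinner : ∀ v w : E, (innerSL ℝ : E →L[ℝ] E →L[ℝ] ℝ) v w = inner ℝ v w := fun _ _ => rfl
    rw [iteratedFDeriv_two_apply, hP', hP''.fderiv]
    simp [hinner, real_inner_comm]
    ring
  simp only [InnerProductSpace.laplacian_eq_iteratedFDeriv_stdOrthonormalBasis, hi,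
    Finset.sum_neg_distrib, Finset.sum_add_distrib, e, hz]
  simp

/-- The Laplacian of a test function, as a test function. -/
noncomputable instance instLaplacianTestFunction {Ω : Opens E} : Laplacian 𝓓(Ω, F) 𝓓(Ω, F) where
  laplacian φ := ⟨Δ ⇑φ, contDiff_laplacian φ.contDiff,
    φ.hasCompactSupport.of_isClosed_subset (isClosed_tsupport _) (tsupport_laplacian_subset φ),
    (tsupport_laplacian_subset φ).trans φ.tsupport_subset⟩

end Laplacian

section TestFunction

variable {E : Type*} [NormedAddCommGroup E] [InnerProductSpace ℝ E] [FiniteDimensional ℝ E]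
  [MeasurableSpace E] [BorelSpace E] {Ω : Opens E}

lemma integrable_testFunction (φ : 𝓓(Ω, ℝ)) : Integrable φ :=
  φ.continuous.integrable_of_hasCompactSupport φ.hasCompactSupport

lemma integrable_mul_testFunction {u : E → ℝ} (hu : LocallyIntegrableOn u Ω) (φ : 𝓓(Ω, ℝ)) :
    Integrable fun x => u x * φ x := by
  simpa [mul_comm] using φ.integrable_bilin (ContinuousLinearMap.mul ℝ ℝ) hu

lemma setIntegral_mul_testFunction (u : E → ℝ) (φ : 𝓓(Ω, ℝ)) :
    ∫ x in Ω, u x * φ x = ∫ x, u x * φ x :=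
  setIntegral_eq_integral_of_forall_compl_eq_zero fun x hx => by
    rw [image_eq_zero_of_notMem_tsupport (fun h => hx (φ.tsupport_subset h)), mul_zero]

lemma integral_mul_laplacian_comm {Ω' : Opens E} (φ : 𝓓(Ω, ℝ)) (ψ : 𝓓(Ω', ℝ)) :
    ∫ x, φ x * Δ ψ x = ∫ x, Δ φ x * ψ x := by
  have h := SchwartzMap.integral_mul_laplacian_right_eq_left (μ := volume)
    (φ.hasCompactSupport.toSchwartzMap φ.contDiff) (ψ.hasCompactSupport.toSchwartzMap ψ.contDiff)
  simpa only [SchwartzMap.laplacian_apply] using! h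

end TestFunction

section WeakInequality

variable {E : Type*} [NormedAddCommGroup E] [InnerProductSpace ℝ E] [FiniteDimensional ℝ E]
  [MeasurableSpace E] [BorelSpace E] {Ω : Opens E}

/-- `Δu ≤ B` on `Ω` in the sense of distributions: `∫ u Δφ ≤ B ∫ φ` for every nonnegative test
function `φ` on `Ω`. -/
structure LaplacianLEOn (Ω : Opens E) (u : E → ℝ) (B : ℝ) : Prop where
  locallyIntegrableOn : LocallyIntegrableOn u Ω
  integral_le : ∀ φ : 𝓓(Ω, ℝ), (∀ x, 0 ≤ φ x) → ∫ x, u x * Δ φ x ≤ B * ∫ x, φ x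

lemma LaplacianLEOn.mono {u : E → ℝ} {B B' : ℝ} (hu : LaplacianLEOn Ω u B) (h : B ≤ B') :
    LaplacianLEOn Ω u B' where
  locallyIntegrableOn := hu.locallyIntegrableOn
  integral_le φ hφ := (hu.integral_le φ hφ).trans
    (mul_le_mul_of_nonneg_right h (integral_nonneg hφ))

lemma AbsLaplacianLEOn.laplacianLEOn {u : E → ℝ} {B : ℝ} (hu : AbsLaplacianLEOn Ω u B) :
    LaplacianLEOn Ω u B := by
  obtain ⟨g, hg, hgB⟩ := hu
  refine ⟨hg.locallyIntegrableOn, fun φ hφ => ?_⟩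
  calc ∫ x, u x * Δ φ x = ∫ x in Ω, u x * Δ φ x := (setIntegral_mul_testFunction u (Δ φ)).symm
    _ = ∫ x in Ω, g x * φ x := hg.integral_eq φ φ.contDiff φ.hasCompactSupport φ.tsupport_subset
    _ ≤ ∫ x in Ω, B * φ x := by
        refine integral_mono_ae
          (integrable_mul_testFunction hg.locallyIntegrableOn_laplacian φ).integrableOn
          ((integrable_testFunction φ).const_mul B).integrableOn ?_
        filter_upwards [hgB] with x hx
        exact mul_le_mul_of_nonneg_right (le_of_abs_le hx) (hφ x)
    _ = B * ∫ x, φ x := by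
        rw [setIntegral_mul_testFunction (fun _ => B) φ, integral_const_mul]

lemma AbsLaplacianLEOn.nonneg (hΩ : (Ω : Set E).Nonempty) {u : E → ℝ} {B : ℝ}
    (hu : AbsLaplacianLEOn Ω u B) : 0 ≤ B := by
  obtain ⟨g, -, hg⟩ := hu
  have : (ae (volume.restrict (Ω : Set E))).NeBot :=
    ae_restrict_neBot.2 (Ω.isOpen.measure_pos volume hΩ).ne'
  obtain ⟨x, hx⟩ := hg.exists
  exact (abs_nonneg _).trans hx

lemma laplacianLEOn_of_laplacian_le {Ω' : Opens E} (ψ : 𝓓(Ω', ℝ)) {B : ℝ}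
    (hB : ∀ x ∈ Ω, Δ ψ x ≤ B) : LaplacianLEOn Ω ψ B where
  locallyIntegrableOn := ψ.continuous.locallyIntegrable.locallyIntegrableOn _
  integral_le φ hφ := by
    rw [integral_mul_laplacian_comm, ← integral_const_mul]
    refine integral_mono (integrable_mul_testFunction
      ((Δ ψ).continuous.locallyIntegrable.locallyIntegrableOn _) φ)
      ((integrable_testFunction φ).const_mul B) fun x => ?_
    by_cases hx : x ∈ Ω
    · exact mul_le_mul_of_nonneg_right (hB x hx) (hφ x)
    · simp [image_eq_zero_of_notMem_tsupport fun h => hx (φ.tsupport_subset h)]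

end WeakInequality

section DualOfL1

variable {α : Type*} {m : MeasurableSpace α} {μ : Measure α}

lemma exists_pos_memLp_two (μ : Measure α) [SigmaFinite μ] :
    ∃ h : α → ℝ, Measurable h ∧ (∀ x, 0 < h x) ∧ MemLp h 2 μ := by
  obtain ⟨w, hw0, hwm, hw⟩ := exists_pos_lintegral_lt_of_sigmaFinite μ one_ne_zero
  have hm : Measurable fun x => √(w x : ℝ) := hwm.coe_nnreal_real.sqrt
  refine ⟨_, hm, fun x => Real.sqrt_pos.2 (hw0 x), ?_⟩
  refine (memLp_two_iff_integrable_sq hm.aestronglyMeasurable).2 ?_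
  simp only [Real.sq_sqrt (NNReal.coe_nonneg _)]
  exact ⟨hwm.coe_nnreal_real.aestronglyMeasurable, by
    simpa [HasFiniteIntegral] using hw.trans ENNReal.one_lt_top⟩

lemma exists_memLp_two_forall_dual_eq_integral (S : StrongDual ℝ (Lp ℝ 1 μ)) {h : α → ℝ}
    (hh : MemLp h 2 μ) : ∃ G : α → ℝ, MemLp G 2 μ ∧ ∀ f (hf : MemLp f 2 μ),
      S ((hh.integrable_mul hf).toL1 _) = ∫ x, G x * f x ∂μ := by
  let J : Lp ℝ 2 μ →L[ℝ] Lp ℝ 1 μ := (ContinuousLinearMap.mul ℝ ℝ).holderL μ 2 2 1 (hh.toLp h)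
  let G : Lp ℝ 2 μ := (InnerProductSpace.toDual ℝ _).symm (S ∘L J)
  refine ⟨G, Lp.memLp G, fun f hf => ?_⟩
  have hJ : J (hf.toLp f) = (hh.integrable_mul hf).toL1 _ := by
    refine Lp.ext ?_
    filter_upwards [(ContinuousLinearMap.mul ℝ ℝ).coeFn_holder (r := 1) (hh.toLp h) (hf.toLp f),
      hh.coeFn_toLp, hf.coeFn_toLp, (hh.integrable_mul hf).coeFn_toL1] with x hx h1 h2 h3
    rw [h3, Pi.mul_apply, ← h1, ← h2]
    exact hx
  calc S ((hh.integrable_mul hf).toL1 _) = inner ℝ G (hf.toLp f) := by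
        rw [InnerProductSpace.toDual_symm_apply, ContinuousLinearMap.comp_apply, hJ]
    _ = ∫ x, G x * f x ∂μ := by
        rw [L2.inner_def]
        refine integral_congr_ae ?_
        filter_upwards [hf.coeFn_toLp] with x hx
        simp [hx, mul_comm]

lemma ae_abs_le_of_forall_dual_eq_integral (S : StrongDual ℝ (Lp ℝ 1 μ)) {h G : α → ℝ}
    (hh : MemLp h 2 μ) (hh0 : ∀ x, 0 < h x) (hG : MemLp G 2 μ)
    (hS : ∀ f (hf : MemLp f 2 μ), S ((hh.integrable_mul hf).toL1 _) = ∫ x, G x * f x ∂μ) :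
    ∀ᵐ x ∂μ, |G x| ≤ ‖S‖ * h x := by
  have hGh : Integrable (fun x => G x * h x) μ := hG.integrable_mul hh
  have hhh : Integrable (fun x => ‖S‖ * (h x * h x)) μ := (hh.integrable_mul hh).const_mul _
  have habs : ∀ s, MeasurableSet s → |∫ x in s, G x * h x ∂μ| ≤ ∫ x in s, ‖S‖ * (h x * h x) ∂μ := by
    intro s hs
    have hsh : MemLp (s.indicator h) 2 μ := hh.indicator hs
    calc |∫ x in s, G x * h x ∂μ| = |∫ x, G x * s.indicator h x ∂μ| := by
          rw [← integral_indicator hs]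
          simp only [Set.indicator_mul_right]
      _ = ‖S ((hh.integrable_mul hsh).toL1 _)‖ := by rw [hS _ hsh, Real.norm_eq_abs]
      _ ≤ ‖S‖ * ‖(hh.integrable_mul hsh).toL1 _‖ := S.le_opNorm _
      _ = ‖S‖ * ∫ x, s.indicator (fun x => h x * h x) x ∂μ := by
          rw [L1.norm_of_fun_eq_integral_norm]
          congr 2 with x
          by_cases hx : x ∈ s <;> simp [hx, abs_of_pos (hh0 x)]
      _ = ∫ x in s, ‖S‖ * (h x * h x) ∂μ := by
          rw [integral_indicator hs, integral_const_mul]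
  have hle : (fun x => G x * h x) ≤ᵐ[μ] fun x => ‖S‖ * (h x * h x) :=
    ae_le_of_forall_setIntegral_le hGh hhh fun s hs _ => (le_abs_self _).trans (habs s hs)
  have hge : (fun x => -(G x * h x)) ≤ᵐ[μ] fun x => ‖S‖ * (h x * h x) :=
    ae_le_of_forall_setIntegral_le hGh.neg hhh fun s hs _ => by
      rw [integral_neg]
      exact (neg_le_abs _).trans (habs s hs)
  filter_upwards [hle, hge] with x h1 h2
  refine le_of_mul_le_mul_right ?_ (hh0 x)
  rw [mul_assoc, ← abs_of_pos (hh0 x), ← abs_mul, abs_of_pos (hh0 x)]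
  exact abs_le'.2 ⟨h1, h2⟩

lemma tendsto_toL1_indicator {f : α → ℝ} (hf : Integrable f μ) {s : ℕ → Set α}
    (hs : ∀ n, MeasurableSet (s n)) (hfs : ∀ x, ∀ᶠ n in atTop, x ∈ s n) :
    Tendsto (fun n => (hf.indicator (hs n)).toL1 _) atTop (𝓝 (hf.toL1 f)) := by
  rw [tendsto_iff_norm_sub_tendsto_zero]
  simp only [← Integrable.toL1_sub, L1.norm_of_fun_eq_integral_norm]
  rw [← integral_zero α ℝ (μ := μ)]
  refine tendsto_integral_of_dominated_convergence (fun x => ‖f x‖)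
    (fun n => ((hf.indicator (hs n)).sub hf).norm.aestronglyMeasurable) hf.norm
    (fun n => ae_of_all _ fun x => ?_) (ae_of_all _ fun x => ?_)
  · by_cases hx : x ∈ s n <;> simp [hx]
  · refine tendsto_const_nhds.congr' ?_
    filter_upwards [hfs x] with n hn
    simp [hn]

lemma dual_eq_integral_of_forall_memLp_two {S : StrongDual ℝ (Lp ℝ 1 μ)} {g h : α → ℝ} {C : ℝ}
    (hg : AEStronglyMeasurable g μ) (hgC : ∀ᵐ x ∂μ, |g x| ≤ C) (hhm : Measurable h)
    (hh0 : ∀ x, 0 < h x) (hh : MemLp h 2 μ) (hS : ∀ f (hf : MemLp f 2 μ),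
      S ((hh.integrable_mul hf).toL1 _) = ∫ x, g x * (h x * f x) ∂μ) (f : Lp ℝ 1 μ) :
    S f = ∫ x, g x * f x ∂μ := by
  have hfm : Measurable f := (Lp.stronglyMeasurable f).measurable
  have hf : Integrable f μ := L1.integrable_coeFn f
  have hgf : Integrable (fun x => g x * f x) μ := hf.bdd_mul hg hgC
  let s : ℕ → Set α := fun n => {x | |f x| ≤ n * (h x * h x)}
  have hs : ∀ n, MeasurableSet (s n) := fun n =>
    measurableSet_le hfm.norm ((hhm.mul hhm).const_mul _)
  have hfs : ∀ x, ∀ᶠ n in atTop, x ∈ s n := fun x => by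
    filter_upwards [eventually_ge_atTop ⌈|f x| / (h x * h x)⌉₊] with n hn
    exact (div_le_iff₀ (mul_pos (hh0 x) (hh0 x))).1 (Nat.ceil_le.1 hn)
  have htrunc : ∀ n, S ((hf.indicator (hs n)).toL1 _) =
      ∫ x, (s n).indicator (fun x => g x * f x) x ∂μ := by
    intro n
    have hfh : MemLp (fun x => (s n).indicator f x / h x) 2 μ := by
      refine (hh.const_mul (n : ℝ)).mono'
        ((hfm.indicator (hs n)).div hhm).aestronglyMeasurable (ae_of_all _ fun x => ?_)
      rw [Real.norm_eq_abs, abs_div, abs_of_pos (hh0 x), div_le_iff₀ (hh0 x), mul_assoc]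
      by_cases hx : x ∈ s n
      · rwa [Set.indicator_of_mem hx]
      · rw [Set.indicator_of_notMem hx, abs_zero]
        exact mul_nonneg n.cast_nonneg (mul_self_nonneg _)
    have htoL1 : (hf.indicator (hs n)).toL1 _ = (hh.integrable_mul hfh).toL1 _ := by
      congr 1 with x
      exact (mul_div_cancel₀ _ (hh0 x).ne').symm
    simp only [htoL1, hS _ hfh, mul_div_cancel₀ _ (hh0 _).ne', Set.indicator_mul_right]
  have hlim := (S.continuous.tendsto _).comp (tendsto_toL1_indicator hf hs hfs)
  rw [Integrable.toL1_coeFn] at hlim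
  refine tendsto_nhds_unique hlim ?_
  simp only [Function.comp_def, htrunc]
  refine tendsto_integral_of_dominated_convergence (fun x => ‖g x * f x‖)
    (fun n => (hgf.indicator (hs n)).aestronglyMeasurable) hgf.norm
    (fun n => ae_of_all _ fun x => norm_indicator_le_norm_self _ _) (ae_of_all _ fun x => ?_)
  refine tendsto_const_nhds.congr' ?_
  filter_upwards [hfs x] with n hn
  rw [Set.indicator_of_mem hn]

/-- The Riesz representation theorem on `L²` applies after composition with multiplication by a
positive square-integrable weight, which maps `L²` densely into `L¹`. -/
theorem exists_forall_dual_eq_integral [SigmaFinite μ] (S : StrongDual ℝ (Lp ℝ 1 μ)) :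
    ∃ g : α → ℝ, AEStronglyMeasurable g μ ∧ (∀ᵐ x ∂μ, |g x| ≤ ‖S‖) ∧
      ∀ f : Lp ℝ 1 μ, S f = ∫ x, g x * f x ∂μ := by
  obtain ⟨h, hhm, hh0, hh⟩ := exists_pos_memLp_two μ
  obtain ⟨G, hG, hS⟩ := exists_memLp_two_forall_dual_eq_integral S hh
  have hgm : AEStronglyMeasurable (fun x => G x / h x) μ :=
    (hG.aestronglyMeasurable.aemeasurable.div hhm.aemeasurable).aestronglyMeasurable
  have hgS : ∀ᵐ x ∂μ, |G x / h x| ≤ ‖S‖ := by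
    filter_upwards [ae_abs_le_of_forall_dual_eq_integral S hh hh0 hG hS] with x hx
    rwa [abs_div, abs_of_pos (hh0 x), div_le_iff₀ (hh0 x)]
  refine ⟨_, hgm, hgS, dual_eq_integral_of_forall_memLp_two hgm hgS hhm hh0 hh fun f hf => ?_⟩
  simp only [hS f hf, ← mul_assoc, div_mul_cancel₀ _ (hh0 _).ne']

end DualOfL1

lemma exists_strongDual_comp_eq {V F : Type*} [AddCommGroup V] [Module ℝ V]
    [NormedAddCommGroup F] [NormedSpace ℝ F] (ι : V →ₗ[ℝ] F) (T : V →ₗ[ℝ] ℝ) {C : ℝ} (hC : 0 ≤ C)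
    (hT : ∀ v, |T v| ≤ C * ‖ι v‖) : ∃ S : StrongDual ℝ F, ‖S‖ ≤ C ∧ ∀ v, S (ι v) = T v := by
  have hker : T ∈ LinearMap.range ι.dualMap := by
    rw [LinearMap.range_dualMap_eq_dualAnnihilator_ker, Submodule.mem_dualAnnihilator]
    intro v hv
    simpa [LinearMap.mem_ker.1 hv] using hT v
  obtain ⟨S₀, hS₀⟩ := hker
  have hS₀v : ∀ v, S₀ (ι v) = T v := LinearMap.congr_fun hS₀
  have hbound : ∀ y : LinearMap.range ι, ‖S₀.domRestrict (LinearMap.range ι) y‖ ≤ C * ‖y‖ := by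
    rintro ⟨_, v, rfl⟩
    simpa [hS₀v] using hT v
  obtain ⟨S, hS, hSnorm⟩ := exists_extension_norm_eq _
    ((S₀.domRestrict (LinearMap.range ι)).mkContinuous C hbound)
  refine ⟨S, hSnorm.trans_le (LinearMap.mkContinuous_norm_le _ hC _), fun v => ?_⟩
  rw [← hS₀v v]
  exact hS ⟨ι v, v, rfl⟩

section Represent

variable {E : Type*} [NormedAddCommGroup E] [InnerProductSpace ℝ E] [FiniteDimensional ℝ E]
  {Ω : Opens E}

lemma exists_cutoff {K : Set E} (hK : IsCompact K) (hKΩ : K ⊆ Ω) :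
    ∃ χ : 𝓓(Ω, ℝ), (∀ x ∈ K, χ x = 1) ∧ ∀ x, χ x ∈ Set.Icc (0 : ℝ) 1 := by
  obtain ⟨δ, hδ, hδΩ⟩ := hK.exists_cthickening_subset_open Ω.isOpen hKΩ
  obtain ⟨χ, h0, h1, h01⟩ := exists_contMDiffMap_zero_one_of_isClosed (n := ⊤)
    (modelWithCornersSelf ℝ E) (isOpen_thickening (δ := δ) (E := K)).isClosed_compl hK.isClosed
    (Set.disjoint_compl_left_iff_subset.2 (self_subset_thickening hδ K))
  have hsub : tsupport χ ⊆ cthickening δ K := by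
    refine closure_minimal (fun x hx => ?_) isClosed_cthickening
    by_contra h
    exact hx (h0 fun h' => h (thickening_subset_cthickening δ K h'))
  exact ⟨⟨χ, χ.contMDiff.contDiff, hK.cthickening.of_isClosed_subset (isClosed_tsupport _) hsub,
    hsub.trans hδΩ⟩, h1, h01⟩

variable [MeasurableSpace E] [BorelSpace E]

lemma exists_testFunction_abs_le (φ : 𝓓(Ω, ℝ)) {ε : ℝ} (hε : 0 < ε) :
    ∃ ψ : 𝓓(Ω, ℝ), (∀ x, |φ x| ≤ ψ x) ∧ ∫ x, ψ x ≤ (∫ x, |φ x|) + ε := by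
  obtain ⟨χ, hχ1, hχ01⟩ := exists_cutoff φ.hasCompactSupport φ.tsupport_subset
  have hIχ : 0 ≤ ∫ x, χ x := integral_nonneg fun x => (hχ01 x).1
  set δ := ε / ((∫ x, χ x) + 1) with hδ
  have hδ0 : 0 < δ := by positivity
  have hδε : δ * ∫ x, χ x ≤ ε := by
    rw [hδ, div_mul_eq_mul_div, div_le_iff₀ (by positivity)]
    nlinarith
  let ψ : 𝓓(Ω, ℝ) := ⟨fun x => χ x * √(φ x ^ 2 + δ ^ 2),
    χ.contDiff.mul (((φ.contDiff.pow 2).add contDiff_const).sqrt fun x => by positivity),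
    χ.hasCompactSupport.mul_right, (tsupport_mul_subset_left (f := χ)).trans χ.tsupport_subset⟩
  have hψ : ∀ x, ψ x = χ x * √(φ x ^ 2 + δ ^ 2) := fun x => rfl
  have hψφ : ∀ x, ψ x ≤ |φ x| + δ * χ x := by
    intro x
    have hsqrt : √(φ x ^ 2 + δ ^ 2) ≤ |φ x| + δ := by
      rw [Real.sqrt_le_iff]
      exact ⟨by positivity, by nlinarith [sq_abs (φ x), abs_nonneg (φ x)]⟩
    calc ψ x ≤ χ x * (|φ x| + δ) := mul_le_mul_of_nonneg_left hsqrt (hχ01 x).1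
      _ = χ x * |φ x| + δ * χ x := by ring
      _ ≤ |φ x| + δ * χ x := by gcongr; exact mul_le_of_le_one_left (abs_nonneg _) (hχ01 x).2
  refine ⟨ψ, fun x => ?_, ?_⟩
  · by_cases hx : x ∈ tsupport φ
    · rw [hψ, hχ1 x hx, one_mul]
      exact Real.abs_le_sqrt (le_add_of_nonneg_right (sq_nonneg δ))
    · rw [image_eq_zero_of_notMem_tsupport hx, abs_zero]
      exact mul_nonneg (hχ01 x).1 (Real.sqrt_nonneg _)
  · calc ∫ x, ψ x ≤ ∫ x, (|φ x| + δ * χ x) :=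
          integral_mono (integrable_testFunction ψ)
            ((integrable_testFunction φ).abs.add ((integrable_testFunction χ).const_mul δ)) hψφ
      _ = (∫ x, |φ x|) + δ * ∫ x, χ x := by
          rw [integral_add (integrable_testFunction φ).abs
            ((integrable_testFunction χ).const_mul δ), integral_const_mul]
      _ ≤ (∫ x, |φ x|) + ε := by gcongr

lemma abs_le_mul_integral_abs_of_nonneg {T : 𝓓(Ω, ℝ) →ₗ[ℝ] ℝ} {B : ℝ} (hB : 0 ≤ B)
    (hT : ∀ φ, (∀ x, 0 ≤ φ x) → |T φ| ≤ B * ∫ x, φ x) (φ : 𝓓(Ω, ℝ)) :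
    |T φ| ≤ B * ∫ x, |φ x| := by
  have hle : ∀ ψ : 𝓓(Ω, ℝ), (∀ x, |φ x| ≤ ψ x) → |T φ| ≤ B * ∫ x, ψ x := by
    intro ψ hψ
    have hp := abs_le.1 <| hT (ψ + φ) fun x => by
      simpa using neg_le_iff_add_nonneg'.1 (neg_le_of_abs_le (hψ x))
    have hm := abs_le.1 <| hT (ψ - φ) fun x => by
      simpa using le_of_abs_le (hψ x)
    have hIp : ∫ x, (ψ + φ) x = (∫ x, ψ x) + ∫ x, φ x :=
      integral_add (integrable_testFunction ψ) (integrable_testFunction φ)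
    have hIm : ∫ x, (ψ - φ) x = (∫ x, ψ x) - ∫ x, φ x :=
      integral_sub (integrable_testFunction ψ) (integrable_testFunction φ)
    rw [map_add, hIp] at hp
    rw [map_sub, hIm] at hm
    rw [abs_le]
    constructor <;> linarith
  refine le_of_forall_pos_le_add fun ε hε => ?_
  obtain ⟨ψ, hφψ, hψ⟩ := exists_testFunction_abs_le φ (ε := ε / (B + 1)) (by positivity)
  calc |T φ| ≤ B * ∫ x, ψ x := hle ψ hφψ
    _ ≤ B * ((∫ x, |φ x|) + ε / (B + 1)) := by gcongr
    _ ≤ (B * ∫ x, |φ x|) + ε := by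
        rw [mul_add]
        gcongr
        rw [← mul_div_assoc, div_le_iff₀ (by positivity)]
        nlinarith

/-- The inclusion of test functions into `L¹`. -/
noncomputable def testFunctionToL1 (Ω : Opens E) : 𝓓(Ω, ℝ) →ₗ[ℝ] Lp ℝ 1 (volume : Measure E) where
  toFun φ := (integrable_testFunction φ).toL1 φ
  map_add' φ ψ := Integrable.toL1_add _ _ (integrable_testFunction φ) (integrable_testFunction ψ)
  map_smul' c φ := Integrable.toL1_smul _ (integrable_testFunction φ) c

theorem exists_forall_eq_integral_mul {T : 𝓓(Ω, ℝ) →ₗ[ℝ] ℝ} {B : ℝ} (hB : 0 ≤ B)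
    (hT : ∀ φ, (∀ x, 0 ≤ φ x) → |T φ| ≤ B * ∫ x, φ x) :
    ∃ g : E → ℝ, AEStronglyMeasurable g ∧ (∀ᵐ x, |g x| ≤ B) ∧ ∀ φ, T φ = ∫ x, g x * φ x := by
  obtain ⟨S, hSB, hS⟩ := exists_strongDual_comp_eq (testFunctionToL1 Ω) T hB fun φ =>
    (abs_le_mul_integral_abs_of_nonneg hB hT φ).trans_eq (congrArg (B * ·)
      (L1.norm_of_fun_eq_integral_norm (integrable_testFunction φ)).symm)
  obtain ⟨g, hgm, hgS, hg⟩ := exists_forall_dual_eq_integral S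
  refine ⟨g, hgm, hgS.mono fun x hx => hx.trans hSB, fun φ => ?_⟩
  rw [← hS, hg]
  refine integral_congr_ae ?_
  filter_upwards [(integrable_testFunction φ).coeFn_toL1] with x hx
  exact congrArg (g x * ·) hx

/-- The distributional Laplacian of `u` on `Ω`, as a linear functional on test functions. -/
noncomputable def weakLaplacian {u : E → ℝ} (hu : LocallyIntegrableOn u Ω) : 𝓓(Ω, ℝ) →ₗ[ℝ] ℝ where
  toFun φ := ∫ x, u x * Δ φ x
  map_add' φ ψ := by
    rw [← integral_add (integrable_mul_testFunction hu (Δ φ))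
      (integrable_mul_testFunction hu (Δ ψ))]
    congr 1 with x
    rw [← mul_add]
    exact congrArg (u x * ·) (ContDiffAt.laplacian_add (contDiff_infty.1 φ.contDiff 2).contDiffAt
      (contDiff_infty.1 ψ.contDiff 2).contDiffAt)
  map_smul' c φ := by
    rw [RingHom.id_apply, smul_eq_mul, ← integral_const_mul]
    congr 1 with x
    rw [mul_left_comm]
    exact congrArg (u x * ·)
      (InnerProductSpace.laplacian_smul c (contDiff_infty.1 φ.contDiff 2).contDiffAt)

theorem LaplacianLEOn.absLaplacianLEOn {u : E → ℝ} {B : ℝ} (hB : 0 ≤ B) (hu : LaplacianLEOn Ω u B)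
    (hu' : LaplacianLEOn Ω (fun x => -u x) B) : AbsLaplacianLEOn Ω u B := by
  obtain ⟨g, hgm, hgB, hg⟩ := exists_forall_eq_integral_mul
    (T := weakLaplacian hu.locallyIntegrableOn) hB fun φ hφ => by
      refine abs_le'.2 ⟨hu.integral_le φ hφ, ?_⟩
      simpa only [neg_mul, integral_neg] using! hu'.integral_le φ hφ
  have hgloc : LocallyIntegrable g := (memLp_top_of_bound hgm B hgB).locallyIntegrable le_top
  refine ⟨g, ⟨hu.locallyIntegrableOn, hgloc.locallyIntegrableOn Ω, fun φ hφ hφc hφΩ => ?_⟩,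
    ae_restrict_of_ae hgB⟩
  let Φ : 𝓓(Ω, ℝ) := ⟨φ, hφ, hφc, hφΩ⟩
  exact (setIntegral_mul_testFunction u (Δ Φ)).trans
    ((hg Φ).trans (setIntegral_mul_testFunction g Φ).symm)

end Represent

section RadialBump

lemma contDiff_deriv_expNegInvGlue : ContDiff ℝ ∞ (deriv expNegInvGlue) :=
  (contDiff_infty_iff_deriv.1 (expNegInvGlue.contDiff (n := ⊤))).2

lemma deriv_expNegInvGlue_of_nonpos {s : ℝ} (hs : s ≤ 0) : deriv expNegInvGlue s = 0 := by
  refine IsLocalMin.deriv_eq_zero (Eventually.of_forall fun t => ?_)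
  rw [expNegInvGlue.zero_of_nonpos hs]
  exact expNegInvGlue.nonneg t

lemma deriv_expNegInvGlue_one_pos : 0 < deriv expNegInvGlue 1 := by
  have h := (expNegInvGlue.hasDerivAt_polynomial_eval_inv_mul 1 1).deriv
  simp only [Polynomial.eval_one, one_mul] at h
  rw [h]
  simpa using expNegInvGlue.pos_of_pos one_pos

variable {E : Type*} [NormedAddCommGroup E]

lemma one_sub_normSq_nonpos {z : E} (hz : 1 ≤ ‖z‖) : 1 - ‖z‖ ^ 2 ≤ 0 := by
  nlinarith

/-- A smooth radial bump function `P` supported in the closed unit ball. -/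
noncomputable def radialBump (z : E) : ℝ := expNegInvGlue (1 - ‖z‖ ^ 2)

/-- The nonnegative radial kernel `K` with `∇P z = -K z • z`, where `P` is `radialBump`. -/
noncomputable def radialKernel (z : E) : ℝ := 2 * deriv expNegInvGlue (1 - ‖z‖ ^ 2)

lemma radialBump_nonneg (z : E) : 0 ≤ radialBump z := expNegInvGlue.nonneg _

lemma radialKernel_nonneg (z : E) : 0 ≤ radialKernel z :=
  mul_nonneg zero_le_two expNegInvGlue.monotone.deriv_nonneg

lemma radialBump_of_one_le {z : E} (hz : 1 ≤ ‖z‖) : radialBump z = 0 :=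
  expNegInvGlue.zero_of_nonpos (one_sub_normSq_nonpos hz)

lemma radialKernel_of_one_le {z : E} (hz : 1 ≤ ‖z‖) : radialKernel z = 0 := by
  rw [radialKernel, deriv_expNegInvGlue_of_nonpos (one_sub_normSq_nonpos hz), mul_zero]

variable [InnerProductSpace ℝ E]

lemma contDiff_one_sub_normSq : ContDiff ℝ ∞ fun z : E => 1 - ‖z‖ ^ 2 :=
  contDiff_const.sub (contDiff_norm_sq ℝ)

lemma contDiff_radialBump : ContDiff ℝ ∞ (radialBump : E → ℝ) :=
  (expNegInvGlue.contDiff (n := ⊤)).comp contDiff_one_sub_normSq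

lemma contDiff_radialKernel : ContDiff ℝ ∞ (radialKernel : E → ℝ) :=
  contDiff_const.mul (contDiff_deriv_expNegInvGlue.comp contDiff_one_sub_normSq)

lemma hasFDerivAt_radialBump (z : E) :
    HasFDerivAt radialBump (-(radialKernel z) • innerSL ℝ z) z := by
  have hsq : HasFDerivAt (fun z : E => ‖z‖ ^ 2) (2 • innerSL ℝ z) z :=
    (hasFDerivAt_id z).norm_sq.congr_fderiv (by ext; simp)
  have hglue : HasDerivAt expNegInvGlue (deriv expNegInvGlue (1 - ‖z‖ ^ 2)) (1 - ‖z‖ ^ 2) :=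
    ((expNegInvGlue.contDiff (n := ⊤)).differentiable (by simp) _).hasDerivAt
  refine (hglue.comp_hasFDerivAt z (hsq.const_sub 1)).congr_fderiv ?_
  ext v
  simp [radialKernel]
  ring

/-- The potential `y ↦ r ^ (1 - d) * P ((y - x) / r)`, where `P` is `radialBump` and `d = dim E`.
Its Laplacian is the derivative with respect to `r` of the mollifier `r ^ (-d) * K ((y - x) / r)`,
where `K` is `radialKernel`. -/
noncomputable def rescaledBump (r : ℝ) (x y : E) : ℝ :=
  r * (r ^ Module.finrank ℝ E)⁻¹ * radialBump (r⁻¹ • (y - x))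

lemma contDiff_rescaledBump (r : ℝ) (x : E) : ContDiff ℝ ∞ (rescaledBump r x) :=
  contDiff_const.mul (contDiff_radialBump.comp (by fun_prop))

lemma rescaledBump_nonneg {r : ℝ} (hr : 0 ≤ r) (x y : E) : 0 ≤ rescaledBump r x y :=
  mul_nonneg (by positivity) (radialBump_nonneg _)

lemma tsupport_rescaledBump_subset {r : ℝ} (hr : 0 < r) (x : E) :
    tsupport (rescaledBump r x) ⊆ closedBall x r := by
  refine closure_minimal (fun y hy => ?_) isClosed_closedBall
  rw [mem_closedBall, dist_eq_norm]
  by_contra! h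
  have hz : 1 ≤ ‖r⁻¹ • (y - x)‖ := by
    rw [norm_smul, norm_inv, Real.norm_of_nonneg hr.le]
    exact (one_le_inv_mul₀ hr).2 h.le
  exact hy (by rw [rescaledBump, radialBump_of_one_le hz, mul_zero])

variable [FiniteDimensional ℝ E]

lemma hasCompactSupport_radialBump : HasCompactSupport (radialBump : E → ℝ) :=
  HasCompactSupport.intro (isCompact_closedBall 0 1) fun z hz =>
    radialBump_of_one_le (by simpa using (not_le.1 (mt mem_closedBall_zero_iff.2 hz)).le)

lemma hasCompactSupport_radialKernel : HasCompactSupport (radialKernel : E → ℝ) :=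
  HasCompactSupport.intro (isCompact_closedBall 0 1) fun z hz =>
    radialKernel_of_one_le (by simpa using (not_le.1 (mt mem_closedBall_zero_iff.2 hz)).le)

lemma laplacian_rescaledBump (r : ℝ) (x y : E) : Δ (rescaledBump r x) y =
    r * (r ^ Module.finrank ℝ E)⁻¹ * (r⁻¹ ^ 2 * Δ (radialBump : E → ℝ) (r⁻¹ • (y - x))) := by
  have hbump : ContDiff ℝ 2 (radialBump : E → ℝ) := contDiff_infty.1 contDiff_radialBump 2
  have hcomp : ContDiff ℝ 2 fun y : E => radialBump (r⁻¹ • (y - x)) := hbump.comp (by fun_prop)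
  have h : rescaledBump r x =
      (r * (r ^ Module.finrank ℝ E)⁻¹) • fun y : E => radialBump (r⁻¹ • (y - x)) := rfl
  rw [h, InnerProductSpace.laplacian_smul _ hcomp.contDiffAt,
    laplacian_comp_smul_sub hbump, smul_eq_mul, smul_eq_mul]

lemma hasDerivAt_rescaledKernel {r : ℝ} (hr : r ≠ 0) (x y : E) :
    HasDerivAt (fun r : ℝ => (r ^ Module.finrank ℝ E)⁻¹ * radialKernel (r⁻¹ • (y - x)))
      (Δ (rescaledBump r x) y) r := by
  have hK : Differentiable ℝ (radialKernel : E → ℝ) :=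
    contDiff_radialKernel.differentiable (by simp)
  have hpow : HasDerivAt (fun r : ℝ => (r ^ Module.finrank ℝ E)⁻¹)
      (-(Module.finrank ℝ E * (r ^ Module.finrank ℝ E)⁻¹ * r⁻¹)) r := by
    refine ((hasDerivAt_pow (Module.finrank ℝ E) r).inv (pow_ne_zero _ hr)).congr_deriv ?_
    cases Module.finrank ℝ E with
    | zero => simp
    | succ n => field_simp; simp [pow_succ]
  have hker := (hK _).hasFDerivAt.comp_hasDerivAt r ((hasDerivAt_inv hr).smul_const (y - x))
  refine (hpow.mul hker).congr_deriv ?_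
  rw [laplacian_rescaledBump,
    laplacian_of_hasFDerivAt_neg_smul_innerSL hasFDerivAt_radialBump (hK _)]
  simp only [map_smul, smul_eq_mul, Function.comp_apply]
  field_simp
  ring

lemma exists_abs_laplacian_rescaledBump_le {a : ℝ} (ha : 0 < a) :
    ∃ C, ∀ r, a ≤ r → ∀ x y : E, |Δ (rescaledBump r x) y| ≤ C := by
  obtain ⟨C, hC⟩ := (contDiff_laplacian (n := ⊤) contDiff_radialBump).continuous
    |>.bounded_above_of_compact_support (hasCompactSupport_radialBump.of_isClosed_subset
      (isClosed_tsupport _) (tsupport_laplacian_subset (radialBump : E → ℝ)))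
  have : 0 ≤ C := (norm_nonneg _).trans (hC 0)
  refine ⟨a⁻¹ * (a ^ Module.finrank ℝ E)⁻¹ * C, fun r hr x y => ?_⟩
  have hr0 : 0 < r := ha.trans_le hr
  calc |Δ (rescaledBump r x) y|
      = r⁻¹ * (r ^ Module.finrank ℝ E)⁻¹ * |Δ (radialBump : E → ℝ) (r⁻¹ • (y - x))| := by
        rw [laplacian_rescaledBump, ← mul_assoc, abs_mul, abs_of_pos (by positivity)]
        field_simp
    _ ≤ a⁻¹ * (a ^ Module.finrank ℝ E)⁻¹ * C := by
        gcongr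
        exact hC _

variable [MeasurableSpace E] [BorelSpace E]

lemma integral_comp_inv_smul_sub (f : E → ℝ) {r : ℝ} (hr : 0 < r) (x : E) :
    ∫ y, f (r⁻¹ • (y - x)) = r ^ Module.finrank ℝ E * ∫ z, f z := by
  rw [integral_sub_right_eq_self (fun y => f (r⁻¹ • y)) x,
    Measure.integral_comp_inv_smul_of_nonneg _ _ hr.le, smul_eq_mul]

lemma integral_rescaledBump {r : ℝ} (hr : 0 < r) (x : E) :
    ∫ y, rescaledBump r x y = r * ∫ z : E, radialBump z := by
  simp only [rescaledBump]
  rw [integral_const_mul, integral_comp_inv_smul_sub _ hr]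
  field_simp

lemma integral_radialBump_pos : 0 < ∫ z : E, radialBump z :=
  contDiff_radialBump.continuous.integral_pos_of_hasCompactSupport_nonneg_nonzero
    hasCompactSupport_radialBump radialBump_nonneg (x := 0) (by simp [radialBump])

lemma integrable_radialKernel : Integrable (radialKernel : E → ℝ) :=
  contDiff_radialKernel.continuous.integrable_of_hasCompactSupport hasCompactSupport_radialKernel

lemma integral_radialKernel_pos : 0 < ∫ z : E, radialKernel z :=
  contDiff_radialKernel.continuous.integral_pos_of_hasCompactSupport_nonneg_nonzero
    hasCompactSupport_radialKernel radialKernel_nonneg (x := 0)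
    (by simpa [radialKernel] using deriv_expNegInvGlue_one_pos.ne')

end RadialBump

section MeasurableLocallyBounded

lemma measurable_indicator_of_upperSemicontinuousOn {X : Type*} [TopologicalSpace X]
    [MeasurableSpace X] [OpensMeasurableSpace X] {D : Set X} (hD : MeasurableSet D) {u : X → ℝ}
    (hu : UpperSemicontinuousOn u D) : Measurable (D.indicator u) := by
  refine measurable_of_restrict_of_restrict_compl hD ?_ ?_
  · have h : D.domRestrict (D.indicator u) = D.domRestrict u :=
      Set.domRestrict_eq_domRestrict_iff.2 fun x hx => Set.indicator_of_mem hx u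
    rw [h]
    exact (upperSemicontinuousOn_iff_restrict.2 hu).measurable
  · have h : Dᶜ.domRestrict (D.indicator u) = fun _ => 0 :=
      funext fun x => Set.indicator_of_notMem x.2 u
    rw [h]
    exact measurable_const

variable {X : Type*} [TopologicalSpace X] [MeasurableSpace X]

/-- `u` is Borel measurable on `D` and bounded on every compact subset of `D`. -/
structure MeasurableLocallyBoundedOn (D : Set X) (u : X → ℝ) : Prop where
  measurable_indicator : Measurable (D.indicator u)
  exists_abs_le : ∀ K ⊆ D, IsCompact K → ∃ C, ∀ x ∈ K, |u x| ≤ C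

variable {D : Set X} {u : X → ℝ}

lemma measurableLocallyBoundedOn_of_continuousOn [OpensMeasurableSpace X] (hD : MeasurableSet D)
    (hu : ContinuousOn u D) : MeasurableLocallyBoundedOn D u where
  measurable_indicator :=
    measurable_indicator_of_upperSemicontinuousOn hD hu.upperSemicontinuousOn
  exists_abs_le _ hK hKc := hKc.exists_bound_of_continuousOn (hu.mono hK)

namespace MeasurableLocallyBoundedOn

lemma neg (hu : MeasurableLocallyBoundedOn D u) : MeasurableLocallyBoundedOn D fun x => -u x where
  measurable_indicator := by
    simpa only [← Set.indicator_neg'] using! hu.measurable_indicator.neg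
  exists_abs_le K hK hKc := by simpa only [abs_neg] using hu.exists_abs_le K hK hKc

lemma exists_abs_indicator_le (hu : MeasurableLocallyBoundedOn D u) {K : Set X} (hK : K ⊆ D)
    (hKc : IsCompact K) : ∃ C, ∀ x, |K.indicator u x| ≤ C := by
  obtain ⟨C, hC⟩ := hu.exists_abs_le K hK hKc
  refine ⟨max C 0, fun x => ?_⟩
  by_cases hx : x ∈ K
  · rw [Set.indicator_of_mem hx]
    exact (hC x hx).trans (le_max_left _ _)
  · rw [Set.indicator_of_notMem hx, abs_zero]
    exact le_max_right _ _

variable [T2Space X] [OpensMeasurableSpace X]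

lemma measurable_indicator_of_isCompact (hu : MeasurableLocallyBoundedOn D u) {K : Set X}
    (hK : K ⊆ D) (hKc : IsCompact K) : Measurable (K.indicator u) := by
  have h : K.indicator u = K.indicator (D.indicator u) := by
    rw [Set.indicator_indicator, Set.inter_eq_left.2 hK]
  rw [h]
  exact hu.measurable_indicator.indicator hKc.measurableSet

lemma integrableOn_of_isCompact {μ : Measure X} [IsFiniteMeasureOnCompacts μ]
    (hu : MeasurableLocallyBoundedOn D u) {K : Set X} (hK : K ⊆ D) (hKc : IsCompact K) :
    IntegrableOn u K μ := by
  obtain ⟨C, hC⟩ := hu.exists_abs_le K hK hKc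
  refine (integrableOn_const (C := C) hKc.measure_lt_top.ne).mono' ?_
    ((ae_restrict_iff' hKc.measurableSet).2 (Eventually.of_forall hC))
  exact (aestronglyMeasurable_indicator_iff hKc.measurableSet).1
    (hu.measurable_indicator_of_isCompact hK hKc).aestronglyMeasurable

end MeasurableLocallyBoundedOn

end MeasurableLocallyBounded

section RadialMean

variable {E : Type*} [NormedAddCommGroup E] [InnerProductSpace ℝ E] [MeasurableSpace E]
  [BorelSpace E]

lemma measurable_ofReal_mul_radialKernel (c : ℝ) :
    Measurable fun z : E => ENNReal.ofReal (c * radialKernel z) :=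
  (contDiff_radialKernel.continuous.measurable.const_mul c).ennreal_ofReal

variable [FiniteDimensional ℝ E]

variable (E) in
/-- The rotation invariant probability measure on the closed unit ball whose density is proportional
to `radialKernel`. -/
noncomputable def radialMeasure : Measure E :=
  volume.withDensity fun z => ENNReal.ofReal ((∫ w : E, radialKernel w)⁻¹ * radialKernel z)

lemma integral_radialMeasure (f : E → ℝ) :
    ∫ z, f z ∂radialMeasure E = (∫ w : E, radialKernel w)⁻¹ * ∫ z, f z * radialKernel z := by
  have h0 : ∀ z : E, 0 ≤ (∫ w : E, radialKernel w)⁻¹ * radialKernel z := fun z =>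
    mul_nonneg (inv_nonneg.2 integral_radialKernel_pos.le) (radialKernel_nonneg z)
  rw [radialMeasure, integral_withDensity_eq_integral_toReal_smul
    (measurable_ofReal_mul_radialKernel _)
    (Eventually.of_forall fun _ => ENNReal.ofReal_lt_top), ← integral_const_mul]
  simp only [ENNReal.toReal_ofReal (h0 _), smul_eq_mul, mul_right_comm _ (radialKernel _),
    mul_assoc]

instance instIsProbabilityMeasureRadialMeasure : IsProbabilityMeasure (radialMeasure E) := by
  constructor
  rw [radialMeasure, withDensity_apply _ .univ, setLIntegral_univ,
    ← ofReal_integral_eq_lintegral_ofReal (integrable_radialKernel.const_mul _)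
      (Eventually.of_forall fun z =>
        mul_nonneg (inv_nonneg.2 integral_radialKernel_pos.le) (radialKernel_nonneg z)),
    integral_const_mul, inv_mul_cancel₀ integral_radialKernel_pos.ne', ENNReal.ofReal_one]

lemma ae_radialMeasure_norm_le_one : ∀ᵐ z ∂radialMeasure E, ‖z‖ ≤ 1 := by
  rw [radialMeasure, ae_withDensity_iff (measurable_ofReal_mul_radialKernel _)]
  refine Eventually.of_forall fun z hz => ?_
  by_contra! h
  exact hz (by rw [radialKernel_of_one_le h.le, mul_zero, ENNReal.ofReal_zero])

lemma integral_radialMeasure_comp (L : E ≃ₗᵢ[ℝ] E) (f : E → ℝ) :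
    ∫ z, f (L z) ∂radialMeasure E = ∫ z, f z ∂radialMeasure E := by
  have h : ∀ z, radialKernel (L z) = radialKernel z := fun z => by
    rw [radialKernel, L.norm_map, radialKernel]
  rw [integral_radialMeasure, integral_radialMeasure]
  congr 1
  simpa only [h] using L.measurePreserving.integral_comp L.toHomeomorph.measurableEmbedding
    fun z => f z * radialKernel z

/-- The mean of `u` over the ball of centre `x` and radius `r`, weighted by the image of
`radialMeasure`. -/
noncomputable def radialMean (u : E → ℝ) (r : ℝ) (x : E) : ℝ :=
  ∫ z, u (x + r • z) ∂radialMeasure E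

variable (E) in
/-- The constant `κ` in the second order expansion `radialMean u r x = u x + κ r² Δu x + o(r²)`. -/
noncomputable def radialMeanCoeff : ℝ :=
  (∫ z : E, radialBump z) / (2 * ∫ z : E, radialKernel z)

lemma radialMeanCoeff_pos : 0 < radialMeanCoeff E :=
  div_pos integral_radialBump_pos (mul_pos two_pos integral_radialKernel_pos)

lemma radialMean_zero (u : E → ℝ) (x : E) : radialMean u 0 x = u x := by
  simp [radialMean]

lemma radialMean_neg (u : E → ℝ) (r : ℝ) (x : E) :
    radialMean (fun y => -u y) r x = -radialMean u r x :=
  integral_neg _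

lemma ae_add_smul_mem_closedBall {r R : ℝ} (hr : 0 ≤ r) (hrR : r ≤ R) (x : E) :
    ∀ᵐ z ∂radialMeasure E, x + r • z ∈ closedBall x R := by
  filter_upwards [ae_radialMeasure_norm_le_one] with z hz
  rw [mem_closedBall, dist_eq_norm, add_sub_cancel_left, norm_smul, Real.norm_of_nonneg hr]
  exact (mul_le_of_le_one_right hr hz).trans hrR

lemma radialMean_indicator (u : E → ℝ) {r R : ℝ} (hr : 0 ≤ r) (hrR : r ≤ R) (x : E) :
    radialMean ((closedBall x R).indicator u) r x = radialMean u r x := by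
  refine integral_congr_ae ?_
  filter_upwards [ae_add_smul_mem_closedBall hr hrR x] with z hz
  rw [Set.indicator_of_mem hz]

lemma radialMean_eq_integral (u : E → ℝ) {r : ℝ} (hr : 0 < r) (x : E) :
    radialMean u r x = (∫ w : E, radialKernel w)⁻¹ *
      ∫ y, u y * ((r ^ Module.finrank ℝ E)⁻¹ * radialKernel (r⁻¹ • (y - x))) := by
  have h := integral_comp_inv_smul_sub (fun z : E => u (x + r • z) * radialKernel z) hr x
  simp only [smul_inv_smul₀ hr.ne', add_sub_cancel] at h
  simp only [mul_left_comm (u _), integral_const_mul]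
  rw [h, radialMean, integral_radialMeasure, inv_mul_cancel_left₀ (pow_pos hr _).ne']

lemma hasDerivAt_radialMean {u : E → ℝ} (hu : Integrable u) {r : ℝ} (hr : 0 < r) (x : E) :
    HasDerivAt (fun r => radialMean u r x)
      ((∫ w : E, radialKernel w)⁻¹ * ∫ y, u y * Δ (rescaledBump r x) y) r := by
  obtain ⟨C, hC⟩ := exists_abs_laplacian_rescaledBump_le (E := E) (half_pos hr)
  have hker : ∀ s : ℝ, Continuous fun y : E =>
      (s ^ Module.finrank ℝ E)⁻¹ * radialKernel (s⁻¹ • (y - x)) := fun s =>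
    continuous_const.mul (contDiff_radialKernel.continuous.comp (by fun_prop))
  obtain ⟨M, hM⟩ := (contDiff_radialKernel (E := E)).continuous.bounded_above_of_compact_support
    hasCompactSupport_radialKernel
  have hint : Integrable fun y =>
      u y * ((r ^ Module.finrank ℝ E)⁻¹ * radialKernel (r⁻¹ • (y - x))) :=
    hu.mul_bdd (c := (r ^ Module.finrank ℝ E)⁻¹ * M) (hker r).aestronglyMeasurable <|
      Eventually.of_forall fun y => by
        rw [norm_mul, Real.norm_of_nonneg (by positivity)]
        gcongr
        exact hM _
  have hs : Set.Ici (r / 2) ∈ 𝓝 r := Ici_mem_nhds (half_lt_self hr)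
  have hderiv := (hasDerivAt_integral_of_dominated_loc_of_deriv_le
    (F := fun s y => u y * ((s ^ Module.finrank ℝ E)⁻¹ * radialKernel (s⁻¹ • (y - x))))
    (F' := fun s y => u y * Δ (rescaledBump s x) y) (bound := fun y => |u y| * C) hs
    (Eventually.of_forall fun s => hu.aestronglyMeasurable.mul (hker s).aestronglyMeasurable) hint
    (hu.aestronglyMeasurable.mul
      (contDiff_laplacian (n := ⊤) (contDiff_rescaledBump r x)).continuous.aestronglyMeasurable)
    (Eventually.of_forall fun y s hs => by
      rw [norm_mul]
      exact mul_le_mul_of_nonneg_left (hC s hs x y) (norm_nonneg _))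
    (hu.abs.mul_const C)
    (Eventually.of_forall fun y s hs =>
      (hasDerivAt_rescaledKernel ((half_pos hr).trans_le hs).ne' x y).const_mul _)).2
  refine (hderiv.const_mul _).congr_of_eventuallyEq ?_
  filter_upwards [hs] with s hs
  exact radialMean_eq_integral u ((half_pos hr).trans_le hs) x

lemma MeasurableLocallyBoundedOn.integrable_comp_add_smul {D : Set E} {u : E → ℝ}
    (hu : MeasurableLocallyBoundedOn D u) {x : E} {r : ℝ} (hr : 0 ≤ r) (hD : closedBall x r ⊆ D) :
    Integrable (fun z => u (x + r • z)) (radialMeasure E) := by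
  have hball := isCompact_closedBall x r
  obtain ⟨C, hC⟩ := hu.exists_abs_indicator_le hD hball
  refine (Integrable.of_bound (((hu.measurable_indicator_of_isCompact hD hball).comp
    (by fun_prop : Measurable fun z => x + r • z)).aestronglyMeasurable) C
    (Eventually.of_forall fun z => hC _)).congr ?_
  filter_upwards [ae_add_smul_mem_closedBall hr le_rfl x] with z hz
  exact Set.indicator_of_mem hz u

lemma continuousOn_radialMean {u : E → ℝ} {x : E} {R : ℝ} (hu : ContinuousOn u (closedBall x R)) :
    ContinuousOn (fun r => radialMean u r x) (Set.Icc 0 R) := by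
  obtain ⟨C, hC⟩ := (isCompact_closedBall x R).exists_bound_of_continuousOn hu
  refine continuousOn_of_dominated (bound := fun _ => C) (fun r hr => ?_) (fun r hr => ?_)
    (integrable_const C) ?_
  · exact ((measurableLocallyBoundedOn_of_continuousOn measurableSet_closedBall hu)
      |>.integrable_comp_add_smul hr.1 (closedBall_subset_closedBall hr.2)).aestronglyMeasurable
  · filter_upwards [ae_add_smul_mem_closedBall hr.1 hr.2 x] with z hz
    exact hC _ hz
  · filter_upwards [ae_radialMeasure_norm_le_one] with z hz
    refine hu.comp (by fun_prop) fun r hr => ?_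
    rw [mem_closedBall, dist_eq_norm, add_sub_cancel_left, norm_smul, Real.norm_of_nonneg hr.1]
    exact (mul_le_of_le_one_right hr.1 hz).trans hr.2

variable {Ω : Opens E}

lemma LaplacianLEOn.integral_mul_laplacian_rescaledBump_le {v : E → ℝ} {B : ℝ}
    (hv : LaplacianLEOn Ω v B) {r : ℝ} (hr : 0 < r) {x : E} (hΩ : closedBall x r ⊆ Ω) :
    ∫ y, v y * Δ (rescaledBump r x) y ≤ B * (r * ∫ z : E, radialBump z) := by
  let φ : 𝓓(Ω, ℝ) := ⟨rescaledBump r x, contDiff_rescaledBump r x,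
    (isCompact_closedBall x r).of_isClosed_subset (isClosed_tsupport _)
      (tsupport_rescaledBump_subset hr x), (tsupport_rescaledBump_subset hr x).trans hΩ⟩
  rw [← integral_rescaledBump hr x]
  exact hv.integral_le φ (rescaledBump_nonneg hr.le x)

lemma LaplacianLEOn.exists_hasDerivAt_radialMean_le {v : E → ℝ} {B : ℝ} (hv : LaplacianLEOn Ω v B)
    {x : E} {r R : ℝ} (hr : 0 < r) (hrR : r < R) (hΩ : closedBall x R ⊆ Ω) :
    ∃ m ≤ B * radialMeanCoeff E * (2 * r), HasDerivAt (fun s => radialMean v s x) m r := by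
  have hint : Integrable ((closedBall x R).indicator v) :=
    (hv.locallyIntegrableOn.integrableOn_compact_subset hΩ
      (isCompact_closedBall x R)).integrable_indicator measurableSet_closedBall
  refine ⟨_, ?_, (hasDerivAt_radialMean hint hr x).congr_of_eventuallyEq ?_⟩
  · have hK := integral_radialKernel_pos (E := E)
    have hcut : ∫ y, (closedBall x R).indicator v y * Δ (rescaledBump r x) y =
        ∫ y, v y * Δ (rescaledBump r x) y := by
      congr 1 with y
      by_cases hy : y ∈ closedBall x R
      · rw [Set.indicator_of_mem hy]
      · have hy' : y ∉ tsupport (Δ (rescaledBump r x)) := fun h =>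
          hy (closedBall_subset_closedBall hrR.le
            (tsupport_rescaledBump_subset hr x (tsupport_laplacian_subset _ h)))
        rw [image_eq_zero_of_notMem_tsupport hy', mul_zero, mul_zero]
    rw [hcut, inv_mul_le_iff₀ hK]
    refine (hv.integral_mul_laplacian_rescaledBump_le hr
      ((closedBall_subset_closedBall hrR.le).trans hΩ)).trans_eq ?_
    rw [radialMeanCoeff]
    field_simp
  · filter_upwards [Ioo_mem_nhds hr hrR] with s hs
    exact (radialMean_indicator v hs.1.le hs.2.le x).symm

theorem LaplacianLEOn.radialMean_le {v : E → ℝ} {B : ℝ} (hv : LaplacianLEOn Ω v B)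
    (hvc : ContinuousOn v Ω) {x : E} {R : ℝ} (hR : 0 ≤ R) (hΩ : closedBall x R ⊆ Ω) :
    radialMean v R x ≤ v x + B * radialMeanCoeff E * R ^ 2 := by
  have hderiv : ∀ r ∈ interior (Set.Icc 0 R), ∃ m ≤ 0,
      HasDerivAt (fun r => radialMean v r x - B * radialMeanCoeff E * r ^ 2) m r := by
    rw [interior_Icc]
    intro r hr
    obtain ⟨m, hm, h⟩ := hv.exists_hasDerivAt_radialMean_le hr.1 hr.2 hΩ
    refine ⟨_, sub_nonpos.2 hm, h.sub ?_⟩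
    simpa using (hasDerivAt_pow 2 r).const_mul (B * radialMeanCoeff E)
  have hanti : AntitoneOn (fun r => radialMean v r x - B * radialMeanCoeff E * r ^ 2)
      (Set.Icc 0 R) := by
    refine antitoneOn_of_deriv_nonpos (convex_Icc 0 R)
      ((continuousOn_radialMean (hvc.mono hΩ)).sub (by fun_prop)) (fun r hr => ?_) fun r hr => ?_
    · obtain ⟨m, -, h⟩ := hderiv r hr
      exact h.differentiableAt.differentiableWithinAt
    · obtain ⟨m, hm, h⟩ := hderiv r hr
      rwa [h.deriv]
  have h := hanti (Set.left_mem_Icc.2 hR) (Set.right_mem_Icc.2 hR) hR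
  simp only [radialMean_zero] at h
  linarith

theorem tendstoUniformly_radialMean_sub_div (φ : 𝓓(Ω, ℝ)) :
    TendstoUniformly (fun r x => (radialMean φ r x - φ x) / (radialMeanCoeff E * r ^ 2))
      (fun x => Δ φ x) (𝓝[>] 0) := by
  refine Metric.tendstoUniformly_iff.2 fun ε hε => ?_
  have huc : UniformContinuous fun x => Δ φ x :=
    (Δ φ).hasCompactSupport.uniformContinuous_of_continuous (Δ φ).continuous
  obtain ⟨δ, hδ, h⟩ := Metric.uniformContinuous_iff.1 huc (ε / 2) (half_pos hε)
  filter_upwards [Ioo_mem_nhdsGT hδ] with r hr x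
  have hclose : ∀ y ∈ ball x δ, |Δ φ y - Δ φ x| < ε / 2 := fun y hy => h hy
  have hneg : ∀ y, Δ (-φ) y = -Δ φ y := fun y =>
    congrFun (InnerProductSpace.laplacian_neg (f := φ)) y
  have hle : LaplacianLEOn ⟨ball x δ, isOpen_ball⟩ φ (Δ φ x + ε / 2) :=
    laplacianLEOn_of_laplacian_le φ fun y hy => by linarith [(abs_lt.1 (hclose y hy)).2]
  have hle' : LaplacianLEOn ⟨ball x δ, isOpen_ball⟩ (-φ) (-Δ φ x + ε / 2) :=
    laplacianLEOn_of_laplacian_le (-φ) fun y hy => by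
      rw [hneg]
      linarith [(abs_lt.1 (hclose y hy)).1]
  have h1 := hle.radialMean_le φ.continuous.continuousOn hr.1.le (closedBall_subset_ball hr.2)
  have h2 := hle'.radialMean_le (-φ).continuous.continuousOn hr.1.le (closedBall_subset_ball hr.2)
  have h3 : radialMean (-⇑φ) r x = -radialMean φ r x := radialMean_neg _ r x
  simp only [Pi.neg_apply] at h2
  have hκ : 0 < radialMeanCoeff E * r ^ 2 := mul_pos radialMeanCoeff_pos (pow_pos hr.1 2)
  rw [dist_comm, Real.dist_eq, abs_lt]
  have hle_div : (radialMean φ r x - φ x) / (radialMeanCoeff E * r ^ 2) ≤ Δ φ x + ε / 2 := by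
    rw [div_le_iff₀ hκ]
    linarith
  have hdiv_le : Δ φ x - ε / 2 ≤ (radialMean φ r x - φ x) / (radialMeanCoeff E * r ^ 2) := by
    rw [le_div_iff₀ hκ]
    linarith
  constructor <;> linarith

end RadialMean

section Duality

variable {E : Type*} [NormedAddCommGroup E] [InnerProductSpace ℝ E] [FiniteDimensional ℝ E]
  [MeasurableSpace E] [BorelSpace E]

lemma integrable_prod_radialMeasure {w φ : E → ℝ} (hw : Measurable w) {C : ℝ} (hC : ∀ x, |w x| ≤ C)
    (hφ : Integrable φ) (r : ℝ) :
    Integrable (fun p : E × E => φ p.1 * w (p.1 + r • p.2)) (volume.prod (radialMeasure E)) :=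
  (hφ.comp_fst _).mul_bdd (hw.comp (by fun_prop)).aestronglyMeasurable
    (Eventually.of_forall fun _ => hC _)

lemma integrable_mul_radialMean {w φ : E → ℝ} (hw : Measurable w) {C : ℝ} (hC : ∀ x, |w x| ≤ C)
    (hφ : Integrable φ) (r : ℝ) : Integrable fun x => φ x * radialMean w r x := by
  simp only [radialMean, ← integral_const_mul]
  exact (integrable_prod_radialMeasure hw hC hφ r).integral_prod_left

lemma integral_mul_radialMean_comm {w φ : E → ℝ} (hw : Measurable w) {C : ℝ} (hC : ∀ x, |w x| ≤ C)
    (hwi : Integrable w) (hφ : Measurable φ) {C' : ℝ} (hC' : ∀ x, |φ x| ≤ C')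
    (hφi : Integrable φ) (r : ℝ) :
    ∫ x, φ x * radialMean w r x = ∫ x, w x * radialMean φ r x := by
  simp only [radialMean, ← integral_const_mul]
  calc ∫ x, ∫ z, φ x * w (x + r • z) ∂radialMeasure E
      = ∫ z, (∫ x, φ x * w (x + r • z)) ∂radialMeasure E :=
        integral_integral_swap (integrable_prod_radialMeasure hw hC hφi r)
    _ = ∫ z, (∫ x, w x * φ (x + r • -z)) ∂radialMeasure E := by
        congr 1 with z
        rw [← integral_add_right_eq_self (fun x => w x * φ (x + r • -z)) (r • z)]
        simp [mul_comm]
    _ = ∫ z, (∫ x, w x * φ (x + r • z)) ∂radialMeasure E :=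
        integral_radialMeasure_comp (LinearIsometryEquiv.neg ℝ)
          fun z => ∫ x, w x * φ (x + r • z)
    _ = ∫ x, ∫ z, w x * φ (x + r • z) ∂radialMeasure E :=
        (integral_integral_swap (integrable_prod_radialMeasure hφ hC' hwi r)).symm

variable {Ω : Opens E}

lemma tendsto_integral_mul_radialMean_sub_div {w : E → ℝ} (hw : Integrable w) (φ : 𝓓(Ω, ℝ)) :
    Tendsto (fun r => ∫ x, w x * ((radialMean φ r x - φ x) / (radialMeanCoeff E * r ^ 2)))
      (𝓝[>] 0) (𝓝 (∫ x, w x * Δ φ x)) := by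
  obtain ⟨C, hC⟩ := (Δ φ).continuous.bounded_above_of_compact_support (Δ φ).hasCompactSupport
  have hlim := tendstoUniformly_radialMean_sub_div φ
  have hmeas : ∀ r, StronglyMeasurable (radialMean φ r) := fun r =>
    (φ.continuous.comp (by fun_prop : Continuous fun p : E × E => p.1 + r • p.2)
      ).stronglyMeasurable.integral_prod_right'
  refine tendsto_integral_filter_of_dominated_convergence (fun x => ‖w x‖ * (C + 1))
    (Eventually.of_forall fun r => hw.aestronglyMeasurable.mul
      (((hmeas r).measurable.sub φ.continuous.measurable).div_const _).aestronglyMeasurable) ?_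
    (hw.norm.mul_const _) (Eventually.of_forall fun x => (hlim.tendsto_at x).const_mul (w x))
  filter_upwards [Metric.tendstoUniformly_iff.1 hlim 1 one_pos] with r hr
  refine Eventually.of_forall fun x => ?_
  rw [norm_mul]
  gcongr
  exact (norm_le_of_mem_closedBall (mem_closedBall'.2 (hr x).le)).trans
    (add_le_add_left (hC x) 1)

lemma integral_mul_laplacian_le_of_radialMean_le {w : E → ℝ} (hw : Measurable w) {C : ℝ}
    (hC : ∀ x, |w x| ≤ C) (hwi : Integrable w) {φ : 𝓓(Ω, ℝ)} (hφ : ∀ x, 0 ≤ φ x) {B : ℝ}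
    (hmean : ∀ᶠ r in 𝓝[>] 0, ∀ x ∈ tsupport φ,
      radialMean w r x ≤ w x + B * radialMeanCoeff E * r ^ 2) :
    ∫ x, w x * Δ φ x ≤ B * ∫ x, φ x := by
  obtain ⟨M, hM⟩ := φ.continuous.bounded_above_of_compact_support φ.hasCompactSupport
  have hφi := integrable_testFunction φ
  have hwφ : Integrable fun x => w x * φ x :=
    integrable_mul_testFunction (hwi.locallyIntegrable.locallyIntegrableOn _) φ
  refine le_of_tendsto (tendsto_integral_mul_radialMean_sub_div hwi φ) ?_
  filter_upwards [hmean, self_mem_nhdsWithin] with r hr hr0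
  have hκ : 0 < radialMeanCoeff E * r ^ 2 := mul_pos radialMeanCoeff_pos (pow_pos hr0 2)
  have hswap : ∫ x, w x * (radialMean φ r x - φ x) = ∫ x, φ x * (radialMean w r x - w x) := by
    simp only [mul_sub]
    rw [integral_sub (integrable_mul_radialMean φ.continuous.measurable hM hwi r) hwφ,
      integral_sub (integrable_mul_radialMean hw hC hφi r) (by simpa only [mul_comm] using hwφ),
      integral_mul_radialMean_comm hw hC hwi φ.continuous.measurable hM hφi]
    simp only [mul_comm]
  have hle : ∫ x, φ x * (radialMean w r x - w x) ≤
      ∫ x, B * (radialMeanCoeff E * r ^ 2) * φ x := by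
    refine integral_mono ?_ (hφi.const_mul _) fun x => ?_
    · simp only [mul_sub]
      exact (integrable_mul_radialMean hw hC hφi r).sub (by simpa only [mul_comm] using hwφ)
    · by_cases hx : x ∈ tsupport φ
      · have h := mul_le_mul_of_nonneg_left (hr x hx) (hφ x)
        simp only
        linarith
      · simp [image_eq_zero_of_notMem_tsupport hx]
  simp only [← mul_div_assoc]
  rw [integral_div, hswap, div_le_iff₀ hκ]
  rw [integral_const_mul] at hle
  linarith

theorem laplacianLEOn_of_radialMean_le {u : E → ℝ} (hu : MeasurableLocallyBoundedOn Ω u) {B : ℝ}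
    (hmean : ∀ x R, 0 ≤ R → closedBall x R ⊆ Ω →
      radialMean u R x ≤ u x + B * radialMeanCoeff E * R ^ 2) : LaplacianLEOn Ω u B where
  locallyIntegrableOn :=
    (locallyIntegrableOn_iff Ω.isOpen.isLocallyClosed).2 fun _ hK hKc =>
      hu.integrableOn_of_isCompact hK hKc
  integral_le φ hφ := by
    obtain ⟨δ, hδ, hδΩ⟩ :=
      φ.hasCompactSupport.isCompact.exists_cthickening_subset_open Ω.isOpen φ.tsupport_subset
    have hKc : IsCompact (cthickening δ (tsupport φ)) := φ.hasCompactSupport.isCompact.cthickening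
    have hsub : tsupport φ ⊆ cthickening δ (tsupport φ) := self_subset_cthickening _
    obtain ⟨C, hC⟩ := hu.exists_abs_indicator_le hδΩ hKc
    have hcut : ∀ x, u x * Δ φ x = (cthickening δ (tsupport φ)).indicator u x * Δ φ x := by
      intro x
      by_cases hx : x ∈ cthickening δ (tsupport φ)
      · rw [Set.indicator_of_mem hx]
      · have hx' : Δ φ x = 0 :=
          image_eq_zero_of_notMem_tsupport fun h => hx (hsub (tsupport_laplacian_subset φ h))
        rw [hx', mul_zero, mul_zero]
    simp only [hcut]
    refine integral_mul_laplacian_le_of_radialMean_le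
      (hu.measurable_indicator_of_isCompact hδΩ hKc) hC
      ((hu.integrableOn_of_isCompact hδΩ hKc).integrable_indicator hKc.measurableSet) hφ ?_
    filter_upwards [Ioo_mem_nhdsGT hδ] with r hr x hx
    have hball : closedBall x r ⊆ cthickening δ (tsupport φ) :=
      (closedBall_subset_closedBall hr.2.le).trans (closedBall_subset_cthickening hx δ)
    have h := hmean x r hr.1.le (hball.trans hδΩ)
    rw [← radialMean_indicator _ hr.1.le le_rfl] at h ⊢
    rw [Set.indicator_indicator, Set.inter_eq_left.2 hball, Set.indicator_of_mem (hsub hx)]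
    exact h

end Duality

section Infimum

lemma UniformlyLocallyBoundedOn.bddBelow {A X : Type*} [TopologicalSpace X] {D : Set X}
    {v : A → X → ℝ} (h : UniformlyLocallyBoundedOn D v) {x : X} (hx : x ∈ D) :
    BddBelow (Set.range fun a => v a x) := by
  obtain ⟨C, hC⟩ := h {x} (Set.singleton_subset_iff.2 hx) isCompact_singleton
  refine ⟨-C, ?_⟩
  rintro _ ⟨a, rfl⟩
  exact neg_le_of_abs_le (hC a x rfl)

lemma UniformlyLocallyBoundedOn.measurableLocallyBoundedOn_iInf {A X : Type*} [Nonempty A]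
    [TopologicalSpace X] [MeasurableSpace X] [OpensMeasurableSpace X] {D : Set X}
    (hD : MeasurableSet D) {v : A → X → ℝ} (hcont : ∀ a, ContinuousOn (v a) D)
    (h : UniformlyLocallyBoundedOn D v) : MeasurableLocallyBoundedOn D fun x => ⨅ a, v a x where
  measurable_indicator := measurable_indicator_of_upperSemicontinuousOn hD <|
    upperSemicontinuousOn_ciInf (fun _ hx => h.bddBelow hx)
      fun a => (hcont a).upperSemicontinuousOn
  exists_abs_le K hK hKc := by
    obtain ⟨C, hC⟩ := h K hK hKc
    refine ⟨C, fun x hx => abs_le.2 ⟨le_ciInf fun a => neg_le_of_abs_le (hC a x hx), ?_⟩⟩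
    obtain ⟨a⟩ := ‹Nonempty A›
    exact (ciInf_le (h.bddBelow (hK hx)) a).trans (le_of_abs_le (hC a x hx))

variable {E : Type*} [NormedAddCommGroup E] [InnerProductSpace ℝ E] [FiniteDimensional ℝ E]
  [MeasurableSpace E] [BorelSpace E] {Ω : Opens E} {A : Type*} [Nonempty A] {v : A → E → ℝ}

lemma radialMean_iInf_le (hcont : ∀ a, ContinuousOn (v a) Ω) (hbdd : UniformlyLocallyBoundedOn Ω v)
    {R : ℝ} (hR : 0 ≤ R) {x : E} (hΩ : closedBall x R ⊆ Ω) (a : A) :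
    radialMean (fun y => ⨅ b, v b y) R x ≤ radialMean (v a) R x := by
  have hΩm := Ω.isOpen.measurableSet
  refine integral_mono_ae
    ((hbdd.measurableLocallyBoundedOn_iInf hΩm hcont).integrable_comp_add_smul hR hΩ)
    ((measurableLocallyBoundedOn_of_continuousOn hΩm (hcont a)).integrable_comp_add_smul hR hΩ) ?_
  filter_upwards [ae_add_smul_mem_closedBall hR le_rfl x] with z hz
  exact ciInf_le (hbdd.bddBelow (hΩ hz)) a

theorem LaplacianLEOn.iInf {B : ℝ} (hcont : ∀ a, ContinuousOn (v a) Ω)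
    (hbdd : UniformlyLocallyBoundedOn Ω v) (hv : ∀ a, LaplacianLEOn Ω (v a) B) :
    LaplacianLEOn Ω (fun x => ⨅ a, v a x) B := by
  refine laplacianLEOn_of_radialMean_le
    (hbdd.measurableLocallyBoundedOn_iInf Ω.isOpen.measurableSet hcont) fun x R hR hΩ => ?_
  rw [← sub_le_iff_le_add]
  refine le_ciInf fun a => ?_
  rw [sub_le_iff_le_add]
  exact (radialMean_iInf_le hcont hbdd hR hΩ a).trans ((hv a).radialMean_le (hcont a) hR hΩ)

end Infimum

section Plurisubharmonic

variable {n : ℕ} {u : EuclideanSpace ℂ (Fin n) → ℝ}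

lemma integral_radialMeasure_comp_smul {ζ : ℂ} (hζ : ‖ζ‖ = 1) :
    ∫ z, u (ζ • z) ∂radialMeasure (EuclideanSpace ℂ (Fin n)) = ∫ z, u z ∂radialMeasure _ :=
  integral_radialMeasure_comp (LinearIsometry.toLinearIsometryEquiv
    { toFun := fun z => ζ • z
      map_add' := smul_add ζ
      map_smul' := smul_comm ζ
      norm_map' := by simp [norm_smul, hζ] } rfl) u

lemma integrable_prod_circleMap (hu : Measurable u) {C : ℝ} (hC : ∀ z, |u z| ≤ C) (r : ℝ)
    (x : EuclideanSpace ℂ (Fin n)) : Integrable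
      (fun p : ℝ × EuclideanSpace ℂ (Fin n) => u (x + circleMap 0 1 p.1 • r • p.2))
      ((volume.restrict (Set.uIoc 0 (2 * Real.pi))).prod (radialMeasure _)) := by
  have : IsFiniteMeasure (volume.restrict (Set.uIoc 0 (2 * Real.pi))) :=
    isFiniteMeasure_restrict.2 measure_Ioc_lt_top.ne
  have hc : Continuous fun p : ℝ × EuclideanSpace ℂ (Fin n) =>
      x + circleMap 0 1 p.1 • r • p.2 := by fun_prop
  exact .of_bound (hu.comp hc.measurable).aestronglyMeasurable C
    (Eventually.of_forall fun _ => hC _)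

lemma integrable_circleAverage_comp_add_smul (hu : Measurable u) {C : ℝ} (hC : ∀ z, |u z| ≤ C)
    (r : ℝ) (x : EuclideanSpace ℂ (Fin n)) :
    Integrable (fun z => Real.circleAverage (fun ζ : ℂ => u (x + ζ • r • z)) 0 1)
      (radialMeasure (EuclideanSpace ℂ (Fin n))) := by
  simp only [Real.circleAverage_def, intervalIntegral.integral_of_le Real.two_pi_pos.le,
    ← Set.uIoc_of_le Real.two_pi_pos.le, smul_eq_mul]
  exact (integrable_prod_circleMap hu hC r x).integral_prod_right.const_mul _

lemma integral_circleAverage_comp_add_smul (hu : Measurable u) {C : ℝ} (hC : ∀ z, |u z| ≤ C)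
    (r : ℝ) (x : EuclideanSpace ℂ (Fin n)) :
    ∫ z, Real.circleAverage (fun ζ : ℂ => u (x + ζ • r • z)) 0 1
      ∂radialMeasure (EuclideanSpace ℂ (Fin n)) = radialMean u r x := by
  have hrot : ∀ θ : ℝ, ∫ z, u (x + circleMap 0 1 θ • r • z) ∂radialMeasure _ =
      radialMean u r x := fun θ => by
    simp only [smul_comm _ r]
    exact integral_radialMeasure_comp_smul (u := fun z => u (x + r • z)) (by simp)
  simp only [Real.circleAverage_def, integral_smul]
  rw [← intervalIntegral_integral_swap (integrable_prod_circleMap hu hC r x)]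
  simp only [hrot, intervalIntegral.integral_const]
  simp [← mul_assoc, Real.pi_ne_zero]

variable {D : Set (EuclideanSpace ℂ (Fin n))}

lemma IsPSHOn.le_radialMean (hpsh : IsPSHOn D u) (hu : MeasurableLocallyBoundedOn D u)
    {x : EuclideanSpace ℂ (Fin n)} {R : ℝ} (hR : 0 ≤ R) (hD : closedBall x R ⊆ D) :
    u x ≤ radialMean u R x := by
  have hball := isCompact_closedBall x R
  have hm := hu.measurable_indicator_of_isCompact hD hball
  obtain ⟨C, hC⟩ := hu.exists_abs_indicator_le hD hball
  have hdisc : ∀ z : EuclideanSpace ℂ (Fin n), ‖z‖ ≤ 1 → ∀ ζ : ℂ, ‖ζ‖ ≤ 1 →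
      x + ζ • R • z ∈ closedBall x R := fun z hz ζ hζ => by
    rw [mem_closedBall, dist_eq_norm, add_sub_cancel_left, norm_smul, norm_smul,
      Real.norm_of_nonneg hR]
    exact (mul_le_of_le_one_left (by positivity) hζ).trans (mul_le_of_le_one_right hR hz)
  rw [← radialMean_indicator u hR le_rfl, ← integral_circleAverage_comp_add_smul hm hC]
  calc u x = ∫ _, u x ∂radialMeasure (EuclideanSpace ℂ (Fin n)) := by simp
    _ ≤ _ := by
      refine integral_mono_ae (integrable_const _)
        (integrable_circleAverage_comp_add_smul hm hC R x) ?_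
      filter_upwards [ae_radialMeasure_norm_le_one] with z hz
      refine (hpsh.le_circleAverage x (R • z) fun ζ hζ => hD (hdisc z hz ζ hζ)).2.trans_eq ?_
      refine Real.circleAverage_congr_sphere fun ζ hζ => ?_
      have hζ' : ‖ζ‖ ≤ 1 := by simpa using hζ.le
      exact (Set.indicator_of_mem (hdisc z hz ζ hζ') u).symm

lemma IsPSHOn.laplacianLEOn_neg {Ω : Opens (EuclideanSpace ℂ (Fin n))} (hpsh : IsPSHOn Ω u)
    (hu : MeasurableLocallyBoundedOn (Ω : Set _) u) : LaplacianLEOn Ω (fun x => -u x) 0 := by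
  refine laplacianLEOn_of_radialMean_le hu.neg fun x R hR hΩ => ?_
  rw [radialMean_neg, zero_mul, zero_mul, add_zero]
  exact neg_le_neg (hpsh.le_radialMean hu hR hΩ)

end Plurisubharmonic

theorem proposition4p3_general {E : Type*} [NormedAddCommGroup E] [InnerProductSpace ℝ E]
    [FiniteDimensional ℝ E] [MeasurableSpace E] [BorelSpace E] {Ω : Opens E} {A : Type*}
    [Nonempty A] {v : A → E → ℝ} (hcont : ∀ a, ContinuousOn (v a) Ω)
    (hbdd : UniformlyLocallyBoundedOn (Ω : Set E) v) {B : ℝ} (hB : 0 ≤ B)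
    (hv : ∀ a, LaplacianLEOn Ω (v a) B) (hinf : LaplacianLEOn Ω (fun x => -⨅ a, v a x) B) :
    AbsLaplacianLEOn (Ω : Set E) (fun x => ⨅ a, v a x) B :=
  (LaplacianLEOn.iInf hcont hbdd hv).absLaplacianLEOn hB hinf

theorem proposition4p3 {n : ℕ} (D : Set (EuclideanSpace ℂ (Fin n))) (hD : IsOpen D)
    (hDc : IsConnected D) {A : Type*} [Nonempty A]
    (v : A → EuclideanSpace ℂ (Fin n) → ℝ) (hcont : ∀ a, ContinuousOn (v a) D)
    (hbdd : UniformlyLocallyBoundedOn D v)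
    (B : ℝ) (hB : ∀ a, AbsLaplacianLEOn D (v a) B)
    (hpsh : IsPSHOn D (fun z => ⨅ a, v a z)) :
    AbsLaplacianLEOn D (fun z => ⨅ a, v a z) B := by
  have hB0 : 0 ≤ B :=
    AbsLaplacianLEOn.nonneg (Ω := ⟨D, hD⟩) hDc.nonempty (hB (Classical.arbitrary A))
  have hinf := IsPSHOn.laplacianLEOn_neg (Ω := ⟨D, hD⟩) hpsh
    (hbdd.measurableLocallyBoundedOn_iInf hD.measurableSet hcont)
  exact proposition4p3_general hcont hbdd hB0 (fun a => (hB a).laplacianLEOn) (hinf.mono hB0)
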